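/- Let $d\ge 1$ and let $\Sigma_\ast$ be a real symmetric positive definite $d\times d$ matrix. For each $n\ge 1$ let $X_1,\dots,X_n$ be i.i.d. with law $\mathcal N(0,\Sigma_\ast)$ on $\mathbb R^d$, and let $\widehat\Sigma_n=\frac1n\sum_{i=1}^n X_iX_i^\top$ be the maximum likelihood estimate of the covariance in the centered Gaussian model. Write $D_{\mathrm{KL}}(P\,\|\,Q)=\mathbb E_{X\sim P}\big[\log\frac{dP}{dQ}(X)\big]$ for the Kullback–Leibler divergence ($+\infty$ if $P\not\ll Q$), and define the reverse KL risk \[ \widetilde{\mathcal E}_n=\mathbb E\Big[D_{\mathrm{KL}}\big(\mathcal N(0,\widehat\Sigma_n)\,\big\|\,\mathcal N(0,\Sigma_\ast)\big)\Big]\in[0,+\infty]. \] If $n\ge d$, then \[ \widetilde{\mathcal E}_n=\frac12\Big(d\log(n/2)-\sum_{j=1}^d\psi\Big(\frac{n-j+1}{2}\Big)\Big), \] where $\psi(x)=\frac{d}{dx}\log\Gamma(x)$ is the digamma function; in particular the risk is finite. Moreover $\widetilde{\mathcal E}_n$ is strictly decreasing in $n$ over the integers $n\ge d$. If $1\le n<d$,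 then $\widetilde{\mathcal E}_n=+\infty$. -/

import Mathlib

open MeasureTheory ProbabilityTheory InformationTheory
open scoped ENNReal

noncomputable section

/-- The digamma function on the reals, the derivative of `log Γ`
(used at positive arguments only). -/
def digamma (x : ℝ) : ℝ := deriv (fun t : ℝ => Real.log (Real.Gamma t)) x

/-- The covariance MLE `(1/n) ∑ xᵢ xᵢᵀ` of the centered Gaussian model,
for data `x₁, …, xₙ` in `ℝᵈ`. -/
def covarianceMLE {d n : ℕ} (x : Fin n → EuclideanSpace ℝ (Fin d)) : Matrix (Fin d) (Fin d) ℝ :=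
  (1 / (n : ℝ)) • ∑ i, Matrix.vecMulVec (x i).ofLp (x i).ofLp

/-- The reverse KL risk `E[D_KL(N(0, Σ̂ₙ) ‖ N(0, S))]` of the covariance MLE `Σ̂ₙ` computed from
the sample `X₁, …, Xₙ`. It is the expectation of a `[0, ∞]`-valued random variable. -/
def reverseKLRisk {d n : ℕ} {Ω : Type*} [MeasurableSpace Ω] (P : Measure Ω)
    (X : Fin n → Ω → EuclideanSpace ℝ (Fin d)) (S : Matrix (Fin d) (Fin d) ℝ) : ℝ≥0∞ :=
  ∫⁻ ω, klDiv (multivariateGaussian 0 (covarianceMLE fun i => X i ω))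
    (multivariateGaussian 0 S) ∂P

end

/-! Write `X i = R Y i` with `R = CFC.sqrt S` and `Y i` standard Gaussian. The estimate becomes `R *
covarianceMLE Y * Rᵀ`, and in the Gaussian divergence `1/2 (tr (S⁻¹ A) - d - log det A + log det S)`
the matrix `S` cancels. The trace of the estimate has mean `d`, so the risk is `-1/2 E[log det
(covarianceMLE Y)]`.

Up to the factor `1/n`, `covarianceMLE Y` is the Gram matrix of the `d` columns of the data, which
are independent standard Gaussian vectors in `ℝⁿ`. Its determinant is a product of squared
distances, each from one column to the span of `j` others (`det_gram_cons`). Given those columns,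
that squared distance is a chi-square variable with `n - j` degrees of freedom, and `E[log χ²ₘ] =
ψ(m/2) + log 2`. Summing over `j < d` gives the formula (`integrable_and_integral_log_det_gram`).

For monotonicity, `log (n/2) - ψ((n-j)/2)` splits into `log (n/(n-j))`, nonincreasing in `n`, and
`log - ψ` at `(n-j)/2`, strictly decreasing. If `n < d` the estimate is singular, so the fitted
Gaussian lives on a Lebesgue-null hyperplane and its divergence is infinite. -/

/-! ### Standard Gaussian vectors and the mean of the log squared norm -/

section StandardGaussian

variable {E : Type*} [NormedAddCommGroup E] [InnerProductSpace ℝ E] [FiniteDimensional ℝ E]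
  [MeasurableSpace E] [BorelSpace E]

open Real in
/-- The standard Gaussian measure as a measure with explicit density. -/
theorem stdGaussian_eq_withDensity :
    stdGaussian E = (volume : Measure E).withDensity fun x =>
      ENNReal.ofReal ((2 * π) ^ (-(Module.finrank ℝ E : ℝ) / 2) * exp (-(1 / 2) * ‖x‖ ^ 2)) := by
  have hc : (0 : ℝ) < (2 * π) ^ (-(Module.finrank ℝ E : ℝ) / 2) := by positivity
  have hcc : (2 * π) ^ (-(Module.finrank ℝ E : ℝ) / 2) *
      (π / (1 / 2)) ^ (Module.finrank ℝ E / 2 : ℝ)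
      = 1 := by
    rw [show π / (1 / 2) = 2 * π by ring, ← rpow_add (by positivity)]
    simp [neg_div]
  have hint :
      ∫ x : E, (2 * π) ^ (-(Module.finrank ℝ E : ℝ) / 2) * exp (-(1 / 2) * ‖x‖ ^ 2) = 1 := by
    rw [integral_const_mul, GaussianFourier.integral_rexp_neg_mul_sq_norm (by norm_num), hcc]
  have hI : Integrable fun x : E =>
      (2 * π) ^ (-(Module.finrank ℝ E : ℝ) / 2) * exp (-(1 / 2) * ‖x‖ ^ 2) :=
    -- A nonintegrable function has integral `0` by convention, so a nonzero integral proves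
    -- integrability.
    not_imp_comm.1 integral_undef (by rw [hint]; norm_num)
  have hfin : IsFiniteMeasure ((volume : Measure E).withDensity fun x =>
      ENNReal.ofReal ((2 * π) ^ (-(Module.finrank ℝ E : ℝ) / 2) * exp (-(1 / 2) * ‖x‖ ^ 2))) :=
    isFiniteMeasure_withDensity_ofReal hI.2
  apply Measure.ext_of_charFun
  ext t
  rw [charFun_stdGaussian, charFun_apply, integral_withDensity_eq_integral_toReal_smul
    (by fun_prop) (ae_of_all _ fun _ => ENNReal.ofReal_lt_top)]
  have h := GaussianFourier.integral_cexp_neg_mul_sq_norm_add (V := E) (b := 1 / 2) (by norm_num)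
    Complex.I t
  calc _ = ((2 * π : ℝ) : ℂ) ^ (-(Module.finrank ℝ E : ℂ) / 2) *
        ((π / (1 / 2) : ℂ) ^ (Module.finrank ℝ E / 2 : ℂ) *
          Complex.exp (Complex.I ^ 2 * ‖t‖ ^ 2 / (4 * (1 / 2)))) := by
        rw [show (π / (1 / 2) : ℂ) = ((2 * π : ℝ) : ℂ) by push_cast; ring, ← mul_assoc,
          ← Complex.cpow_add _ _ (by exact_mod_cast (by positivity : (2 * π) ≠ 0))]
        simp only [neg_div, neg_add_cancel, Complex.cpow_zero, one_mul, Complex.I_sq]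
        congr 1
        ring
    _ = _ := by
        rw [← h, ← integral_const_mul]
        refine integral_congr_ae (ae_of_all _ fun x => ?_)
        simp only
        rw [ENNReal.toReal_ofReal (by positivity), Complex.real_smul, Complex.exp_add]
        push_cast [Complex.ofReal_cpow (by positivity : (0 : ℝ) ≤ 2 * π)]
        rw [real_inner_comm, mul_comm (Complex.I)]
        ring

theorem stdGaussian_absolutelyContinuous_volume : stdGaussian E ≪ (volume : Measure E) := by
  rw [stdGaussian_eq_withDensity]
  exact withDensity_absolutelyContinuous _ _

open Real in
/-- Up to a constant factor, the moment generating function of the logarithm of half the squared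
norm of a standard Gaussian vector is a translate of the Gamma function. -/
theorem exists_mgf_log_norm_sq_stdGaussian [Nontrivial E] :
    ∃ K : ℝ, ∀ s : ℝ, -(Module.finrank ℝ E : ℝ) / 2 < s →
      mgf (fun x : E => log (‖x‖ ^ 2 / 2)) (stdGaussian E) s =
        K * Gamma (Module.finrank ℝ E / 2 + s) := by
  set m := Module.finrank ℝ E with hm
  have hmpos : 1 ≤ m := Module.finrank_pos
  set c : ℝ := (2 * π) ^ (-(m : ℝ) / 2)
  have hc : 0 < c := by positivity
  refine ⟨m * (volume : Measure E).real (Metric.ball 0 1) * c * (2 : ℝ) ^ ((m : ℝ) / 2) / 2,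
    fun s hs => ?_⟩
  rw [mgf, stdGaussian_eq_withDensity, integral_withDensity_eq_integral_toReal_smul
    (by fun_prop) (ae_of_all _ fun _ => ENNReal.ofReal_lt_top)]
  have hpolar := integral_fun_norm_addHaar (volume : Measure E)
    (fun y : ℝ => c * exp (-(1 / 2) * y ^ 2) * exp (s * log (y ^ 2 / 2)))
  have hleft : ∫ x : E, (ENNReal.ofReal (c * exp (-(1 / 2) * ‖x‖ ^ 2))).toReal •
      exp (s * log (‖x‖ ^ 2 / 2)) =
      ∫ x : E, c * exp (-(1 / 2) * ‖x‖ ^ 2) * exp (s * log (‖x‖ ^ 2 / 2)) := by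
    refine integral_congr_ae (ae_of_all _ fun x => ?_)
    simp only [smul_eq_mul]
    rw [ENNReal.toReal_ofReal (by positivity)]
  have hright : ∫ y in Set.Ioi (0 : ℝ), y ^ (m - 1) •
      (c * exp (-(1 / 2) * y ^ 2) * exp (s * log (y ^ 2 / 2))) =
      c * 2 ^ (-s) *
        ∫ y in Set.Ioi (0 : ℝ), y ^ ((m : ℝ) - 1 + 2 * s) * exp (-(1 / 2) * y ^ (2 : ℝ)) := by
    rw [← integral_const_mul]
    refine setIntegral_congr_fun measurableSet_Ioi fun y (hy : 0 < y) => ?_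
    have h1 : exp (s * log (y ^ 2 / 2)) = 2 ^ (-s) * y ^ (2 * s) := by
      rw [mul_comm s, ← rpow_def_of_pos (by positivity), div_rpow (by positivity) (by norm_num),
        rpow_neg (by norm_num), rpow_mul hy.le, rpow_two]
      ring
    have h2 : y ^ (m - 1) = y ^ ((m : ℝ) - 1) := by
      rw [← rpow_natCast, Nat.cast_sub hmpos, Nat.cast_one]
    simp only [smul_eq_mul]
    rw [h1, h2, rpow_add hy, rpow_two]
    ring
  rw [hleft, hpolar, ← hm, hright, integral_rpow_mul_exp_neg_mul_rpow (by norm_num) (by linarith)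
    (by norm_num)]
  rw [show ((m : ℝ) - 1 + 2 * s + 1) / 2 = m / 2 + s by ring,
    show -((m : ℝ) - 1 + 2 * s + 1) / 2 = -(m / 2 + s) by ring, one_div, inv_rpow (by norm_num),
    rpow_neg (by norm_num) s, rpow_neg (by norm_num) (m / 2 + s), inv_inv,
    rpow_add (by norm_num)]
  have : (2 : ℝ) ^ s ≠ 0 := by positivity
  simp only [nsmul_eq_mul, smul_eq_mul]
  field_simp

open Real in
/-- The logarithm of half the squared norm of a standard Gaussian vector in dimension `m` is
integrable, with mean `ψ(m / 2)`. -/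
theorem integrable_and_integral_log_half_norm_sq_stdGaussian [Nontrivial E] :
    Integrable (fun x : E => log (‖x‖ ^ 2 / 2)) (stdGaussian E) ∧
      ∫ x : E, log (‖x‖ ^ 2 / 2) ∂(stdGaussian E) = digamma ((Module.finrank ℝ E : ℝ) / 2) := by
  obtain ⟨K, hK⟩ := exists_mgf_log_norm_sq_stdGaussian (E := E)
  have hm : (0 : ℝ) < Module.finrank ℝ E := by exact_mod_cast Module.finrank_pos
  set m := Module.finrank ℝ E
  -- At `s = 0` the moment generating function is `1`. Nothing more about `K` is needed: it becomes
  -- an additive constant in the cumulant generating function, whose derivative at `0` is the mean.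
  have hK0 : K ≠ 0 := by
    rintro rfl
    simpa using hK 0 (by linarith)
  have hset : Set.Ioi (-(m : ℝ) / 2) ⊆
      integrableExpSet (fun x : E => log (‖x‖ ^ 2 / 2)) (stdGaussian E) := by
    intro s hs
    refine not_imp_comm.1 integral_undef ?_
    have := hK s hs
    rw [mgf] at this
    rw [this]
    exact mul_ne_zero hK0 (Gamma_pos_of_pos (by have : -(m : ℝ) / 2 < s := hs; linarith)).ne'
  have h0 : (0 : ℝ) ∈ interior
      (integrableExpSet (fun x : E => log (‖x‖ ^ 2 / 2)) (stdGaussian E)) :=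
    mem_interior_iff_mem_nhds.2 (Filter.mem_of_superset (Ioi_mem_nhds (by linarith)) hset)
  refine ⟨integrable_of_mem_interior_integrableExpSet h0, ?_⟩
  have hd := deriv_cgf_zero h0
  rw [probReal_univ, div_one] at hd
  rw [← hd]
  have hev : cgf (fun x : E => log (‖x‖ ^ 2 / 2)) (stdGaussian E) =ᶠ[nhds 0]
      fun s => log K + log (Gamma (m / 2 + s)) := by
    filter_upwards [Ioi_mem_nhds (show -(m : ℝ) / 2 < 0 by linarith)] with s hs
    rw [cgf, hK s hs,
      log_mul hK0 (Gamma_pos_of_pos (by have : -(m : ℝ) / 2 < s := hs; linarith)).ne']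
  rw [hev.deriv_eq, deriv_const_add, digamma]
  have := deriv_comp_const_add (f := fun t : ℝ => log (Gamma t)) ((m : ℝ) / 2) 0
  rw [this, add_zero]

/-- `E[log ‖X‖²] = ψ(m / 2) + log 2` for a standard Gaussian vector `X` in dimension `m`. -/
theorem integrable_and_integral_log_norm_sq_stdGaussian [Nontrivial E] :
    Integrable (fun x : E => Real.log (‖x‖ ^ 2)) (stdGaussian E) ∧
      ∫ x : E, Real.log (‖x‖ ^ 2) ∂(stdGaussian E) =
        digamma ((Module.finrank ℝ E : ℝ) / 2) + Real.log 2 := by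
  obtain ⟨hi, he⟩ := integrable_and_integral_log_half_norm_sq_stdGaussian (E := E)
  -- At `x = 0` the identity below fails, since `Real.log 0 = 0`.
  have hne : ∀ᵐ x ∂(stdGaussian E), x ≠ 0 := by
    refine stdGaussian_absolutelyContinuous_volume.ae_le ?_
    exact compl_mem_ae_iff.2 (measure_singleton 0)
  have hae : (fun x : E => Real.log (‖x‖ ^ 2)) =ᵐ[stdGaussian E]
      fun x => Real.log (‖x‖ ^ 2 / 2) + Real.log 2 := by
    filter_upwards [hne] with x hx
    have : ‖x‖ ^ 2 ≠ 0 := by simpa using hx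
    rw [Real.log_div this (by norm_num)]
    ring
  refine ⟨(hi.add (integrable_const _)).congr hae.symm, ?_⟩
  rw [integral_congr_ae hae, integral_add hi (integrable_const _), he]
  simp

/-- The orthogonal projection of a standard Gaussian vector to a subspace is standard Gaussian. -/
theorem map_orthogonalProjection_stdGaussian (U : Submodule ℝ E) :
    (stdGaussian E).map U.orthogonalProjectionOnto = stdGaussian U := by
  have : IsProbabilityMeasure ((stdGaussian E).map U.orthogonalProjectionOnto) :=
    Measure.isProbabilityMeasure_map (by fun_prop)
  apply Measure.ext_of_charFun
  ext t
  rw [charFun_stdGaussian, charFun_apply, integral_map (by fun_prop) (by fun_prop)]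
  have h := charFun_stdGaussian (t : E)
  rw [charFun_apply] at h
  simpa using h

end StandardGaussian

/-- The old family is the first factor, so that Fubini fixes it and integrates over the new vector.
-/
theorem measurePreserving_cons_pi {E : Type*} [MeasurableSpace E] (γ : Measure E)
    [SigmaFinite γ] (k : ℕ) :
    MeasurePreserving (fun z : (Fin k → E) × E => (Fin.cons z.2 z.1 : Fin (k + 1) → E))
      ((Measure.pi fun _ => γ).prod γ) (Measure.pi fun _ => γ) := by
  have h := (measurePreserving_piFinSuccAbove (fun _ : Fin (k + 1) => γ) 0).symm
  have h2 := h.comp (Measure.measurePreserving_swap (μ := Measure.pi fun _ : Fin k => γ) (ν := γ))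
  convert h2 using 1
  ext z : 1
  simp [MeasurableEquiv.piFinSuccAbove, Fin.consEquiv]

/-! ### Gram determinants of Gaussian families -/

section GramDeterminant

variable {E : Type*} [NormedAddCommGroup E] [InnerProductSpace ℝ E]

/-- Adjoining a vector `w` to a family `v` multiplies its Gram determinant by the squared distance
of `w` to the span of `v`. -/
theorem det_gram_cons [FiniteDimensional ℝ E] {k : ℕ} (w : E) (v : Fin k → E) :
    (Matrix.gram ℝ (Fin.cons w v : Fin (k + 1) → E)).det =
      ‖(Submodule.span ℝ (Set.range v))ᗮ.orthogonalProjectionOnto w‖ ^ 2 *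
        (Matrix.gram ℝ v).det := by
  set V := Submodule.span ℝ (Set.range v)
  set u : Fin (k + 1) → E := Fin.cons w v
  set p : E := (V.orthogonalProjectionOnto w : E)
  set q : E := (Vᗮ.orthogonalProjectionOnto w : E)
  have hpq : w = q + p := by
    rw [add_comm]
    exact (V.starProjection_add_starProjection_orthogonal w).symm
  have hp : p ∈ V := (V.orthogonalProjectionOnto w).2
  have hq : q ∈ Vᗮ := (Vᗮ.orthogonalProjectionOnto w).2
  -- The columns stay tied to the fixed family `u`, so `Φ` is alternating in the row vectors alone.
  -- Its first argument can then be split as `q + p`, and the `p` term vanishes by linear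
  -- dependence.
  let L : E →ₗ[ℝ] (Fin (k + 1) → ℝ) := LinearMap.pi fun j => (innerₗ E).flip (u j)
  let Φ : E [⋀^Fin (k + 1)]→ₗ[ℝ] ℝ := Matrix.detRowAlternating.compLinearMap L
  have hΦ : ∀ x : E, Φ (Fin.cons x v) =
      (Matrix.of fun i j => inner ℝ ((Fin.cons x v : Fin (k + 1) → E) i) (u j)).det := fun x => rfl
  have hsplit : Φ (Fin.cons w v) = Φ (Fin.cons q v) := by
    have h0 : Φ (Fin.cons p v) = 0 := by
      apply Φ.map_linearDependent
      rw [linearIndependent_finCons]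
      exact fun h => h.2 hp
    have := Φ.toMultilinearMap.cons_add v q p
    simp only [AlternatingMap.coe_multilinearMap] at this
    conv_lhs => rw [hpq]
    rw [this, h0, add_zero]
  have hgram : (Matrix.gram ℝ u).det = Φ (Fin.cons w v) := by
    rw [hΦ]
    rfl
  rw [hgram, hsplit, hΦ, Matrix.det_succ_row_zero, Finset.sum_eq_single 0]
  · have hqw : inner ℝ q w = ‖Vᗮ.orthogonalProjectionOnto w‖ ^ 2 := by
      calc inner ℝ q w = inner ℝ q q + inner ℝ q p := by rw [← inner_add_right, ← hpq]
        _ = ‖q‖ ^ 2 := by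
          rw [V.inner_left_of_mem_orthogonal hp hq, add_zero, real_inner_self_eq_norm_sq]
    simp only [Fin.val_zero, pow_zero, one_mul, Matrix.of_apply, Fin.cons_zero, u, hqw]
    congr 1
  · intro j _ hj
    obtain ⟨i, rfl⟩ := Fin.exists_succ_eq.2 hj
    simp only [Matrix.of_apply, Fin.cons_zero, Fin.cons_succ, u]
    rw [V.inner_left_of_mem_orthogonal (Submodule.subset_span ⟨i, rfl⟩) hq]
    simp
  · simp

variable [FiniteDimensional ℝ E] [MeasurableSpace E] [BorelSpace E]

theorem measurable_det_gram (k : ℕ) :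
    Measurable fun v : Fin k → E => (Matrix.gram ℝ v).det := by
  apply Continuous.measurable
  unfold Matrix.gram
  exact Continuous.matrix_det (by fun_prop)

/-- Rotation invariance of the standard Gaussian measure: integrals of radial functions depend only
on the dimension. -/
theorem integral_norm_stdGaussian (f : ℝ → ℝ) :
    ∫ x : E, f ‖x‖ ∂(stdGaussian E) =
      ∫ x : EuclideanSpace ℝ (Fin (Module.finrank ℝ E)), f ‖x‖
        ∂(stdGaussian (EuclideanSpace ℝ (Fin (Module.finrank ℝ E)))) := by
  let e := (stdOrthonormalBasis ℝ E).repr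
  rw [← stdGaussian_map e,
    MeasurableEmbedding.integral_map (f := e) e.toHomeomorph.measurableEmbedding]
  simp

/-- Projecting a standard Gaussian vector on the orthogonal complement of `k` independent vectors
leaves a squared norm whose logarithm has mean `ψ((n - k) / 2) + log 2`. -/
theorem integrable_and_integral_log_norm_sq_projection {k : ℕ} (hk : k < Module.finrank ℝ E)
    {v : Fin k → E} (hv : LinearIndependent ℝ v) :
    Integrable (fun w : (Submodule.span ℝ (Set.range v))ᗮ => Real.log (‖w‖ ^ 2))
        (stdGaussian (Submodule.span ℝ (Set.range v))ᗮ) ∧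
      ∫ w : (Submodule.span ℝ (Set.range v))ᗮ, Real.log (‖w‖ ^ 2)
        ∂(stdGaussian (Submodule.span ℝ (Set.range v))ᗮ) =
          digamma (((Module.finrank ℝ E : ℝ) - k) / 2) + Real.log 2 := by
  have hdim := (Submodule.span ℝ (Set.range v)).finrank_add_finrank_orthogonal
  rw [finrank_span_eq_card hv, Fintype.card_fin] at hdim
  have hnt : Nontrivial (Submodule.span ℝ (Set.range v))ᗮ :=
    (Module.finrank_pos_iff (R := ℝ)).1 (by omega)
  have h := integrable_and_integral_log_norm_sq_stdGaussian
    (E := (Submodule.span ℝ (Set.range v))ᗮ)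
  rw [← hdim]
  push_cast
  rw [add_sub_cancel_left]
  exact h

theorem measurableSet_linearIndependent (k : ℕ) :
    MeasurableSet {v : Fin k → E | LinearIndependent ℝ v} := by
  simp_rw [← Matrix.det_gram_ne_zero_iff_linearIndependent (𝕜 := ℝ)]
  exact (measurable_det_gram k (measurableSet_singleton 0)).compl

/-- At most `dim E` independent standard Gaussian vectors are almost surely linearly
independent. -/
theorem ae_linearIndependent_pi_stdGaussian {k : ℕ} (hk : k ≤ Module.finrank ℝ E) :
    ∀ᵐ v ∂(Measure.pi fun _ : Fin k => stdGaussian E), LinearIndependent ℝ v := by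
  induction k with
  | zero => exact ae_of_all _ fun v => linearIndependent_empty_type
  | succ k ih =>
    have hmp := measurePreserving_cons_pi (stdGaussian E) k
    rw [← hmp.map_eq, ae_map_iff hmp.measurable.aemeasurable (measurableSet_linearIndependent _)]
    refine (Measure.ae_prod_iff_ae_ae
      (hmp.measurable (measurableSet_linearIndependent _))).2 ?_
    filter_upwards [ih (by omega)] with v hv
    have hne : Submodule.span ℝ (Set.range v) ≠ ⊤ := by
      intro h
      have := finrank_span_eq_card hv
      rw [h, finrank_top, Fintype.card_fin] at this
      omega
    have h0 : ∀ᵐ w ∂(stdGaussian E), w ∉ Submodule.span ℝ (Set.range v) :=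
      stdGaussian_absolutelyContinuous_volume.ae_le
        (compl_mem_ae_iff.2 (Measure.addHaar_submodule volume _ hne))
    filter_upwards [h0] with w hw
    exact linearIndependent_finCons.2 ⟨hv, hw⟩

open Real in
/-- **Bartlett decomposition**: the log-determinant of the Gram matrix of `k` independent standard
Gaussian vectors in dimension `n ≥ k` is integrable, with mean
`∑_{j < k} (ψ((n - j) / 2) + log 2)`. -/
theorem integrable_and_integral_log_det_gram {k : ℕ} (hk : k ≤ Module.finrank ℝ E) :
    Integrable (fun v : Fin k → E => log (Matrix.gram ℝ v).det)
        (Measure.pi fun _ => stdGaussian E) ∧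
      ∫ v : Fin k → E, log (Matrix.gram ℝ v).det ∂(Measure.pi fun _ => stdGaussian E) =
        ∑ j ∈ Finset.range k, (digamma (((Module.finrank ℝ E : ℝ) - j) / 2) + log 2) := by
  induction k with
  | zero => simp
  | succ k ih =>
    obtain ⟨hi, he⟩ := ih (by omega)
    set γ := stdGaussian E
    set ν : Measure (Fin k → E) := Measure.pi fun _ => γ
    have hmp := measurePreserving_cons_pi γ k
    set f : (Fin k → E) × E → ℝ :=
      fun z => log (Matrix.gram ℝ (Fin.cons z.2 z.1 : Fin (k + 1) → E)).det
    set g : (Fin k → E) × E → ℝ := fun z => f z - log (Matrix.gram ℝ z.1).det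
    have hfm : Measurable f := ((measurable_det_gram (k + 1)).comp hmp.measurable).log
    have hgm : Measurable g := hfm.sub ((measurable_det_gram k).comp measurable_fst).log
    have hLI : ∀ᵐ v ∂ν, ∀ᵐ w ∂γ, LinearIndependent ℝ (Fin.cons w v : Fin (k + 1) → E) := by
      have := ae_linearIndependent_pi_stdGaussian (E := E) hk
      rw [← hmp.map_eq, ae_map_iff hmp.measurable.aemeasurable
        (measurableSet_linearIndependent _)] at this
      exact Measure.ae_ae_of_ae_prod this
    have hg : ∀ᵐ v ∂ν, ∀ᵐ w ∂γ, g (v, w) =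
        log (‖(Submodule.span ℝ (Set.range v))ᗮ.orthogonalProjectionOnto w‖ ^ 2) := by
      filter_upwards [hLI] with v hv
      filter_upwards [hv] with w hw
      have h := Matrix.det_gram_ne_zero_iff_linearIndependent (𝕜 := ℝ).2 hw
      rw [det_gram_cons] at h
      simp only [g, f]
      rw [det_gram_cons, log_mul (left_ne_zero_of_mul h) (right_ne_zero_of_mul h),
        add_sub_cancel_right]
    -- The third clause moves the `L¹` norm to a Euclidean space not depending on `v`: this norm is
    -- a.e. constant, which makes the Fubini integrability criterion immediate.
    have hproj : ∀ᵐ v ∂ν, Integrable (fun w => g (v, w)) γ ∧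
        ∫ w, g (v, w) ∂γ = digamma (((Module.finrank ℝ E : ℝ) - k) / 2) + log 2 ∧
        ∫ w, ‖g (v, w)‖ ∂γ =
          ∫ x : EuclideanSpace ℝ (Fin (Module.finrank ℝ E - k)), |log (‖x‖ ^ 2)|
            ∂(stdGaussian (EuclideanSpace ℝ (Fin (Module.finrank ℝ E - k)))) := by
      filter_upwards [hg, ae_linearIndependent_pi_stdGaussian (E := E) (k := k) (by omega)]
        with v hgv hv
      set U := (Submodule.span ℝ (Set.range v))ᗮ
      obtain ⟨h1, h2⟩ := integrable_and_integral_log_norm_sq_projection (by omega) hv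
      have hmap := map_orthogonalProjection_stdGaussian U
      have hdim : Module.finrank ℝ E - k = Module.finrank ℝ U := by
        have hdim : Module.finrank ℝ (Submodule.span ℝ (Set.range v)) + Module.finrank ℝ U =
          Module.finrank ℝ E := Submodule.finrank_add_finrank_orthogonal _
        rw [finrank_span_eq_card hv, Fintype.card_fin] at hdim
        omega
      have hlog : Measurable fun w : U => log (‖w‖ ^ 2) := (measurable_norm.pow_const 2).log
      have hn : ∫ w, ‖g (v, w)‖ ∂γ = ∫ x : U, |log (‖x‖ ^ 2)| ∂(stdGaussian U) := by
        rw [← hmap, integral_map (by fun_prop) hlog.abs.aestronglyMeasurable]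
        refine integral_congr_ae ?_
        filter_upwards [hgv] with w hw
        rw [hw, norm_eq_abs]
      rw [hn, integral_norm_stdGaussian (fun r => |log (r ^ 2)|), ← hdim]
      rw [← hmap, integral_map (by fun_prop) hlog.aestronglyMeasurable] at h2
      rw [← hmap, integrable_map_measure hlog.aestronglyMeasurable (by fun_prop)] at h1
      exact ⟨h1.congr (hgv.mono fun w hw => hw.symm), (integral_congr_ae hgv).trans h2, rfl⟩
    have hgi : Integrable g (ν.prod γ) := by
      refine (integrable_prod_iff hgm.aestronglyMeasurable).2 ⟨hproj.mono fun v hv => hv.1, ?_⟩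
      exact (integrable_const _).congr (hproj.mono fun v hv => hv.2.2.symm)
    have hge : ∫ z, g z ∂(ν.prod γ) = digamma (((Module.finrank ℝ E : ℝ) - k) / 2) + log 2 := by
      rw [integral_prod _ hgi, integral_congr_ae (hproj.mono fun v hv => hv.2.1)]
      simp
    have hfst : Integrable (fun z : (Fin k → E) × E => log (Matrix.gram ℝ z.1).det)
        (ν.prod γ) := hi.comp_fst γ
    have hfg : f = fun z => log (Matrix.gram ℝ z.1).det + g z := by
      funext z
      simp [g]
    have hfi : Integrable f (ν.prod γ) := by
      rw [hfg]
      exact hfst.add hgi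
    have hm := (measurable_det_gram (E := E) (k + 1)).log
    rw [← hmp.map_eq]
    refine ⟨(integrable_map_measure hm.aestronglyMeasurable hmp.measurable.aemeasurable).2 hfi, ?_⟩
    rw [integral_map hmp.measurable.aemeasurable hm.aestronglyMeasurable]
    change ∫ z, f z ∂(ν.prod γ) = _
    rw [hfg, integral_add hfst hgi, hge, Finset.sum_range_succ, ← he]
    congr 1
    exact (integral_fun_fst (μ := ν) (ν := γ) fun v => log (Matrix.gram ℝ v).det).trans (by simp)

end GramDeterminant

/-! ### Densities and divergences of centered Gaussians -/

section MultivariateGaussian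

open Matrix
open scoped MatrixOrder

variable {ι : Type*} [Fintype ι] [DecidableEq ι]

theorem isHermitian_sqrt (S : Matrix ι ι ℝ) : (CFC.sqrt S).IsHermitian :=
  (CFC.sqrt_nonneg S).isSelfAdjoint

theorem det_sqrt_sq {S : Matrix ι ι ℝ} (hS : S.PosSemidef) : (CFC.sqrt S).det ^ 2 = S.det := by
  rw [sq, ← det_mul, CFC.sqrt_mul_sqrt_self S hS.nonneg]

theorem multivariateGaussian_zero_eq_map (S : Matrix ι ι ℝ) :
    multivariateGaussian 0 S =
      (stdGaussian (EuclideanSpace ℝ ι)).map (toEuclideanCLM (𝕜 := ℝ) (CFC.sqrt S)) := by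
  simp [multivariateGaussian]

open Real in
/-- The density of a nondegenerate centered Gaussian measure. -/
theorem multivariateGaussian_eq_withDensity {S : Matrix ι ι ℝ} (hS : S.PosDef) :
    multivariateGaussian 0 S = (volume : Measure (EuclideanSpace ℝ ι)).withDensity fun x =>
      ENNReal.ofReal ((2 * π) ^ (-(Module.finrank ℝ (EuclideanSpace ℝ ι) : ℝ) / 2) *
        exp (-(1 / 2) * log S.det - 1 / 2 * (x.ofLp ⬝ᵥ S⁻¹ *ᵥ x.ofLp))) := by
  set R := CFC.sqrt S
  set c : ℝ := (2 * π) ^ (-(Module.finrank ℝ (EuclideanSpace ℝ ι) : ℝ) / 2)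
  set T := toEuclideanCLM (𝕜 := ℝ) R
  have hRR : R * R = S := CFC.sqrt_mul_sqrt_self S hS.posSemidef.nonneg
  have hdet2 : R.det ^ 2 = S.det := det_sqrt_sq hS.posSemidef
  have hdet : R.det ≠ 0 := by
    intro h
    rw [h] at hdet2
    exact hS.det_pos.ne (by simpa using hdet2)
  have hT : T.toLinearMap.det = R.det := by
    rw [coe_toEuclideanCLM_eq_toEuclideanLin, toEuclideanLin, toLpLin_eq_toLin, LinearMap.det_toLin]
  have hquad : ∀ y : EuclideanSpace ℝ ι, (T y).ofLp ⬝ᵥ S⁻¹ *ᵥ (T y).ofLp = ‖y‖ ^ 2 := by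
    intro y
    have hu : IsUnit R.det := hdet.isUnit
    rw [ofLp_toEuclideanCLM, ← hRR, Matrix.mul_inv_rev, mulVec_mulVec, Matrix.mul_assoc,
      nonsing_inv_mul _ hu, Matrix.mul_one, dotProduct_comm, dotProduct_mulVec,
      ← mulVec_transpose, mulVec_mulVec]
    have : Rᵀ = R := isHermitian_sqrt S
    rw [this, mul_nonsing_inv _ hu, one_mulVec, EuclideanSpace.real_norm_sq_eq]
    simp [dotProduct, sq]
  have habs : exp (-(1 / 2) * log S.det) * |R.det| = 1 := by
    have h1 : log S.det = 2 * log |R.det| := by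
      rw [← hdet2, log_pow, log_abs]
      norm_num
    rw [h1, show -(1 / 2) * (2 * log |R.det|) = -log |R.det| by ring, Real.exp_neg,
      exp_log (abs_pos.2 hdet), inv_mul_cancel₀ (abs_pos.2 hdet).ne']
  -- Change of variables `x = T y`: the Jacobian `|det R|` cancels the factor `(det S)^(-1/2)` of
  -- the density by `habs`.
  have hmap : (volume : Measure (EuclideanSpace ℝ ι)) =
      ENNReal.ofReal |R.det| • (volume : Measure (EuclideanSpace ℝ ι)).map T := by
    have h := Measure.map_linearMap_addHaar_eq_smul_addHaar
      (volume : Measure (EuclideanSpace ℝ ι)) (f := T.toLinearMap) (by rwa [hT])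
    rw [hT] at h
    change volume.map T = _ at h
    rw [h, smul_smul, ← ENNReal.ofReal_mul (abs_nonneg _), abs_inv,
      mul_inv_cancel₀ (abs_pos.2 hdet).ne', ENNReal.ofReal_one, one_smul]
  have hmeas : Measurable fun x : EuclideanSpace ℝ ι => ENNReal.ofReal (c *
        exp (-(1 / 2) * log S.det - 1 / 2 * (x.ofLp ⬝ᵥ S⁻¹ *ᵥ x.ofLp))) := by
    refine (Continuous.measurable ?_).ennreal_ofReal
    fun_prop
  refine Measure.ext_of_lintegral _ fun f hf => ?_
  rw [multivariateGaussian_zero_eq_map, lintegral_map hf (by fun_prop),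
    stdGaussian_eq_withDensity, lintegral_withDensity_eq_lintegral_mul _ (by fun_prop)
      (by fun_prop), lintegral_withDensity_eq_lintegral_mul _ hmeas hf]
  conv_rhs => rw [hmap]
  rw [lintegral_smul_measure, lintegral_map (hmeas.mul hf) (by fun_prop), smul_eq_mul,
    ← lintegral_const_mul _ (by fun_prop)]
  refine lintegral_congr fun y => ?_
  simp only [Pi.mul_apply]
  rw [hquad, ← mul_assoc, ← ENNReal.ofReal_mul (abs_nonneg _), sub_eq_add_neg, exp_add]
  congr 2
  rw [show |R.det| * (c * (exp (-(1 / 2) * log S.det) * exp (-(1 / 2 * ‖y‖ ^ 2)))) =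
    (exp (-(1 / 2) * log S.det) * |R.det|) * (c * exp (-(1 / 2 * ‖y‖ ^ 2))) by ring, habs,
    one_mul, neg_mul]

theorem multivariateGaussian_absolutelyContinuous_volume {S : Matrix ι ι ℝ} (hS : S.PosDef) :
    multivariateGaussian 0 S ≪ (volume : Measure (EuclideanSpace ℝ ι)) := by
  rw [multivariateGaussian_eq_withDensity hS]
  exact withDensity_absolutelyContinuous _ _

open Real in
/-- The density of a nondegenerate centered Gaussian measure with respect to another one. -/
theorem multivariateGaussian_eq_withDensity_multivariateGaussian {A S : Matrix ι ι ℝ}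
    (hA : A.PosDef) (hS : S.PosDef) :
    multivariateGaussian 0 A = (multivariateGaussian 0 S).withDensity fun x =>
      ENNReal.ofReal (exp (1 / 2 * (log S.det - log A.det) +
        1 / 2 * (x.ofLp ⬝ᵥ S⁻¹ *ᵥ x.ofLp) - 1 / 2 * (x.ofLp ⬝ᵥ A⁻¹ *ᵥ x.ofLp))) := by
  rw [multivariateGaussian_eq_withDensity hA, multivariateGaussian_eq_withDensity hS,
    ← withDensity_mul]
  · congr 1
    ext x
    simp only [Pi.mul_apply]
    rw [← ENNReal.ofReal_mul (by have := pi_pos; positivity), mul_assoc, ← exp_add]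
    congr 3
    ring
  · refine (Continuous.measurable ?_).ennreal_ofReal
    fun_prop
  · refine (Continuous.measurable ?_).ennreal_ofReal
    fun_prop

theorem integrable_and_integral_mul_multivariateGaussian {A : Matrix ι ι ℝ} (hA : A.PosSemidef)
    (i j : ι) :
    Integrable (fun x : EuclideanSpace ℝ ι => x i * x j) (multivariateGaussian 0 A) ∧
      ∫ x : EuclideanSpace ℝ ι, x i * x j ∂(multivariateGaussian 0 A) = A i j := by
  have hL : ∀ i, MemLp (fun x : EuclideanSpace ℝ ι => x i) 2 (multivariateGaussian 0 A) := by
    intro i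
    have h : MemLp (id : EuclideanSpace ℝ ι → EuclideanSpace ℝ ι) 2 (multivariateGaussian 0 A) :=
      IsGaussian.memLp_two_id
    exact (EuclideanSpace.proj (𝕜 := ℝ) i).comp_memLp' h
  have h0 : ∀ i, ∫ x : EuclideanSpace ℝ ι, x i ∂(multivariateGaussian 0 A) = 0 := by
    intro i
    have h := (EuclideanSpace.proj (𝕜 := ℝ) i).integral_comp_comm
      (IsGaussian.integrable_id (μ := multivariateGaussian 0 A))
    simpa using h
  refine ⟨(hL i).integrable_mul (hL j), ?_⟩
  have h := covariance_eval_multivariateGaussian (μ := 0) hA i j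
  rw [covariance_eq_sub (hL i) (hL j), h0, h0] at h
  simpa using h

/-- The mean of a quadratic form under a centered Gaussian measure. -/
theorem integrable_and_integral_quadratic_multivariateGaussian {A : Matrix ι ι ℝ}
    (hA : A.PosSemidef) (M : Matrix ι ι ℝ) :
    Integrable (fun x : EuclideanSpace ℝ ι => x.ofLp ⬝ᵥ M *ᵥ x.ofLp) (multivariateGaussian 0 A) ∧
      ∫ x : EuclideanSpace ℝ ι, x.ofLp ⬝ᵥ M *ᵥ x.ofLp ∂(multivariateGaussian 0 A) =
        (M * A).trace := by
  have hq : (fun x : EuclideanSpace ℝ ι => x.ofLp ⬝ᵥ M *ᵥ x.ofLp) =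
      fun x => ∑ i, ∑ j, M i j * (x i * x j) := by
    funext x
    simp only [dotProduct, mulVec, Finset.mul_sum]
    exact Finset.sum_congr rfl fun i _ => Finset.sum_congr rfl fun j _ => by ring
  have hi : ∀ i j, Integrable (fun x : EuclideanSpace ℝ ι => M i j * (x i * x j))
      (multivariateGaussian 0 A) := fun i j =>
    (integrable_and_integral_mul_multivariateGaussian hA i j).1.const_mul _
  rw [hq]
  refine ⟨integrable_finsetSum _ fun i _ => integrable_finsetSum _ fun j _ => hi i j, ?_⟩
  rw [integral_finsetSum _ fun i _ => integrable_finsetSum _ fun j _ => hi i j]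
  simp only [trace, diag_apply, mul_apply]
  refine Finset.sum_congr rfl fun i _ => ?_
  rw [integral_finsetSum _ fun j _ => hi i j]
  refine Finset.sum_congr rfl fun j _ => ?_
  rw [integral_const_mul, (integrable_and_integral_mul_multivariateGaussian hA i j).2,
    ← hA.1.apply i j]
  simp

open Real in
/-- The Kullback–Leibler divergence between nondegenerate centered Gaussian measures. -/
theorem klDiv_multivariateGaussian {A S : Matrix ι ι ℝ} (hA : A.PosDef) (hS : S.PosDef) :
    0 ≤ 1 / 2 * ((S⁻¹ * A).trace - Fintype.card ι - (log A.det - log S.det)) ∧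
    klDiv (multivariateGaussian 0 A) (multivariateGaussian 0 S) =
      ENNReal.ofReal
        (1 / 2 * ((S⁻¹ * A).trace - Fintype.card ι - (log A.det - log S.det))) := by
  set ρ : EuclideanSpace ℝ ι → ℝ := fun x => 1 / 2 * (log S.det - log A.det) +
        1 / 2 * (x.ofLp ⬝ᵥ S⁻¹ *ᵥ x.ofLp) - 1 / 2 * (x.ofLp ⬝ᵥ A⁻¹ *ᵥ x.ofLp) with hρ
  have hd : multivariateGaussian 0 A =
      (multivariateGaussian 0 S).withDensity fun x => ENNReal.ofReal (exp (ρ x)) :=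
    multivariateGaussian_eq_withDensity_multivariateGaussian hA hS
  have hac : multivariateGaussian 0 A ≪ multivariateGaussian 0 S := by
    rw [hd]
    exact withDensity_absolutelyContinuous _ _
  have hρm : Measurable ρ := by
    apply Continuous.measurable
    fun_prop
  have hllr : llr (multivariateGaussian 0 A) (multivariateGaussian 0 S)
      =ᵐ[multivariateGaussian 0 A] ρ := by
    have h := (multivariateGaussian 0 S).rnDeriv_withDensity hρm.exp.ennreal_ofReal
    rw [← hd] at h
    filter_upwards [hac.ae_le h] with x hx
    simp only [llr_def]
    rw [hx, ENNReal.toReal_ofReal (exp_pos _).le, log_exp]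
  obtain ⟨hi1, he1⟩ := integrable_and_integral_quadratic_multivariateGaussian hA.posSemidef S⁻¹
  obtain ⟨hi2, he2⟩ := integrable_and_integral_quadratic_multivariateGaussian hA.posSemidef A⁻¹
  have hi3 : Integrable (fun _ => 1 / 2 * (log S.det - log A.det)) (multivariateGaussian 0 A) :=
    integrable_const _
  have hρi : Integrable ρ (multivariateGaussian 0 A) :=
    (hi3.add (hi1.const_mul _)).sub (hi2.const_mul _)
  have hint : ∫ x, llr (multivariateGaussian 0 A) (multivariateGaussian 0 S) x
      ∂(multivariateGaussian 0 A) =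
      1 / 2 * ((S⁻¹ * A).trace - Fintype.card ι - (log A.det - log S.det)) := by
    have h13 : Integrable (fun x : EuclideanSpace ℝ ι => 1 / 2 * (log S.det - log A.det) +
        1 / 2 * (x.ofLp ⬝ᵥ S⁻¹ *ᵥ x.ofLp)) (multivariateGaussian 0 A) :=
      hi3.add (hi1.const_mul _)
    rw [integral_congr_ae hllr, integral_sub h13 (hi2.const_mul _),
      integral_add hi3 (hi1.const_mul _), integral_const, integral_const_mul,
      integral_const_mul, he1, he2,
      nonsing_inv_mul _ hA.det_pos.ne'.isUnit, trace_one]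
    simp
    ring
  have hli := hρi.congr hllr.symm
  -- Gibbs' inequality: both total masses are `1`, so the closed form is itself nonnegative and
  -- `ENNReal.ofReal` truncates nothing.
  have hnn := integral_llr_add_sub_measure_univ_nonneg hac hli
  have hkl := klDiv_of_ac_of_integrable hac hli
  rw [hint, probReal_univ, probReal_univ, add_sub_cancel_right] at hnn hkl
  exact ⟨hnn, hkl⟩

/-- A degenerate centered Gaussian measure has infinite divergence from a nondegenerate one. -/
theorem klDiv_multivariateGaussian_of_det_eq_zero {A S : Matrix ι ι ℝ} (hA : A.PosSemidef)
    (hdet : A.det = 0) (hS : S.PosDef) :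
    klDiv (multivariateGaussian 0 A) (multivariateGaussian 0 S) = ∞ := by
  apply klDiv_of_not_ac
  intro hac
  obtain ⟨v, hv, hAv⟩ := exists_mulVec_eq_zero_iff.2 hdet
  set R := CFC.sqrt A
  -- `‖R v‖² = ⟨v, A v⟩ = 0`, so every sample `R y` is orthogonal to `v`.
  have hRv : R *ᵥ v = 0 := by
    have h : (R *ᵥ v) ⬝ᵥ (R *ᵥ v) = 0 := by
      have hR : Rᵀ = R := isHermitian_sqrt A
      rw [dotProduct_mulVec, ← mulVec_transpose, hR, mulVec_mulVec,
        CFC.sqrt_mul_sqrt_self A hA.nonneg, hAv, zero_dotProduct]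
    exact dotProduct_self_eq_zero.1 h
  let H : Submodule ℝ (EuclideanSpace ℝ ι) := (ℝ ∙ WithLp.toLp 2 v)ᗮ
  have hH : H ≠ ⊤ := by
    intro h
    rw [Submodule.orthogonal_eq_top_iff, Submodule.span_singleton_eq_bot] at h
    exact hv (by simpa using h)
  have h0 : multivariateGaussian 0 A H = 0 :=
    hac (multivariateGaussian_absolutelyContinuous_volume hS
      (Measure.addHaar_submodule volume H hH))
  have h1 : multivariateGaussian 0 A H = 1 := by
    rw [multivariateGaussian_zero_eq_map, Measure.map_apply (by fun_prop)
      H.closed_of_finiteDimensional.measurableSet]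
    convert measure_univ (μ := stdGaussian (EuclideanSpace ℝ ι))
    ext x
    simp only [Set.mem_preimage, Set.mem_univ, iff_true, SetLike.mem_coe, H,
      Submodule.mem_orthogonal_singleton_iff_inner_right]
    rw [inner_toEuclideanCLM, dotProduct_mulVec, ← mulVec_transpose]
    have hR : Rᵀ = R := isHermitian_sqrt A
    change Rᵀ *ᵥ v ⬝ᵥ _ = 0
    rw [hR, hRv, zero_dotProduct]
  rw [h0] at h1
  exact zero_ne_one h1

end MultivariateGaussian

/-! ### The covariance estimate of a standard Gaussian sample -/

section Sample

open Matrix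

theorem pi_map_curry {ι κ α : Type*} [Fintype ι] [Fintype κ] [MeasurableSpace α]
    (g : Measure α) [IsProbabilityMeasure g] :
    (Measure.pi fun _ : ι × κ => g).map (MeasurableEquiv.curry ι κ α) =
      Measure.pi fun _ : ι => Measure.pi fun _ : κ => g := by
  have := Measure.infinitePi_map_curry (fun (_ : ι) (_ : κ) => g)
  simpa only [Measure.infinitePi_eq_pi] using this

/-- Exchanging rows and columns preserves a product measure with equal factors. -/
theorem map_swap_pi_pi {ι κ α : Type*} [Fintype ι] [Fintype κ] [MeasurableSpace α]
    (g : Measure α) [IsProbabilityMeasure g] :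
    (Measure.pi fun _ : ι => Measure.pi fun _ : κ => g).map (fun z j i => z i j) =
      Measure.pi fun _ : κ => Measure.pi fun _ : ι => g := by
  rw [← pi_map_curry, ← pi_map_curry,
    ← Measure.pi_map_piCongrLeft (Equiv.prodComm ι κ) (fun _ => g),
    Measure.map_map (by fun_prop) (by fun_prop), Measure.map_map (by fun_prop) (by fun_prop)]
  congr 1

variable {d n : ℕ}

/-- The `j`-th coordinates of the observations, as vectors indexed by the sample. -/
def sampleColumns (x : Fin n → EuclideanSpace ℝ (Fin d)) : Fin d → EuclideanSpace ℝ (Fin n) :=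
  fun j => WithLp.toLp 2 fun i => x i j

theorem measurable_sampleColumns : Measurable (sampleColumns (d := d) (n := n)) := by
  unfold sampleColumns
  fun_prop

/-- The data matrix has i.i.d. `N(0, 1)` entries, so transposing it only exchanges the roles of `n`
and `d`. -/
theorem map_sampleColumns_pi_stdGaussian :
    (Measure.pi fun _ : Fin n => stdGaussian (EuclideanSpace ℝ (Fin d))).map sampleColumns =
      Measure.pi fun _ : Fin d => stdGaussian (EuclideanSpace ℝ (Fin n)) := by
  have h : ∀ d n : ℕ, (Measure.pi fun _ : Fin n => stdGaussian (EuclideanSpace ℝ (Fin d))) =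
      (Measure.pi fun _ : Fin n => Measure.pi fun _ : Fin d => gaussianReal 0 1).map
        fun z i => WithLp.toLp 2 (z i) := by
    intro d n
    have hs : ∀ _ : Fin n, SigmaFinite ((Measure.pi fun _ : Fin d => gaussianReal 0 1).map
        (WithLp.toLp 2)) := fun _ => by
      rw [map_pi_eq_stdGaussian]
      infer_instance
    rw [Measure.pi_map_pi (fun _ => by fun_prop)]
    simp_rw [map_pi_eq_stdGaussian]
  rw [h d n, h n d, ← map_swap_pi_pi (ι := Fin n) (κ := Fin d),
    Measure.map_map measurable_sampleColumns (by fun_prop),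
    Measure.map_map (by fun_prop) (by fun_prop)]
  rfl

theorem covarianceMLE_eq_gram (x : Fin n → EuclideanSpace ℝ (Fin d)) :
    covarianceMLE x = (1 / (n : ℝ)) • gram ℝ (sampleColumns x) := by
  rw [covarianceMLE]
  congr 1
  ext j k
  simp only [Matrix.sum_apply, vecMulVec_apply, gram_apply, sampleColumns, PiLp.inner_apply]
  exact Finset.sum_congr rfl fun i _ => by simp [mul_comm]

theorem posSemidef_covarianceMLE (x : Fin n → EuclideanSpace ℝ (Fin d)) :
    (covarianceMLE x).PosSemidef := by
  rw [covarianceMLE_eq_gram]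
  exact (posSemidef_gram ℝ _).smul (by positivity)

theorem det_covarianceMLE (x : Fin n → EuclideanSpace ℝ (Fin d)) :
    (covarianceMLE x).det = (1 / (n : ℝ)) ^ d * (gram ℝ (sampleColumns x)).det := by
  rw [covarianceMLE_eq_gram, det_smul, Fintype.card_fin]

/-- `d` columns in `ℝⁿ` are linearly dependent when `n < d`. -/
theorem det_covarianceMLE_of_lt (hnd : n < d) (x : Fin n → EuclideanSpace ℝ (Fin d)) :
    (covarianceMLE x).det = 0 := by
  rw [det_covarianceMLE]
  refine mul_eq_zero_of_right _ (by_contra fun h => ?_)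
  have := (det_gram_ne_zero_iff_linearIndependent.1 h).fintype_card_le_finrank
  simp at this
  omega

theorem continuous_covarianceMLE :
    Continuous (covarianceMLE : (Fin n → EuclideanSpace ℝ (Fin d)) → _) := by
  unfold covarianceMLE
  refine Continuous.const_smul (continuous_finsetSum Finset.univ fun i _ => ?_) (1 / (n : ℝ))
  exact Continuous.matrix_vecMulVec (by fun_prop) (by fun_prop)

/-- This equivariance reduces a general covariance to the identity. -/
theorem covarianceMLE_map (R : Matrix (Fin d) (Fin d) ℝ)
    (y : Fin n → EuclideanSpace ℝ (Fin d)) :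
    covarianceMLE (fun i => toEuclideanCLM (𝕜 := ℝ) R (y i)) = R * covarianceMLE y * Rᵀ := by
  simp only [covarianceMLE, ofLp_toEuclideanCLM, Matrix.mul_smul, Matrix.smul_mul,
    Matrix.mul_sum, Matrix.sum_mul]
  congr 1
  refine Finset.sum_congr rfl fun i _ => ?_
  rw [mul_vecMulVec, vecMulVec_mul, vecMul_transpose]

theorem ae_det_covarianceMLE_ne_zero (hd : 1 ≤ d) (hn : d ≤ n) :
    ∀ᵐ y ∂(Measure.pi fun _ : Fin n => stdGaussian (EuclideanSpace ℝ (Fin d))),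
      (covarianceMLE y).det ≠ 0 := by
  have h := ae_linearIndependent_pi_stdGaussian (E := EuclideanSpace ℝ (Fin n)) (k := d)
    (by simpa using hn)
  rw [← map_sampleColumns_pi_stdGaussian] at h
  filter_upwards [ae_of_ae_map measurable_sampleColumns.aemeasurable h] with y hy
  rw [det_covarianceMLE]
  have : (0 : ℝ) < n := by exact_mod_cast (by omega : 0 < n)
  exact mul_ne_zero (by positivity) (det_gram_ne_zero_iff_linearIndependent.2 hy)

/-- The mean log-determinant of the covariance estimate of a standard Gaussian sample. -/
theorem integrable_and_integral_log_det_covarianceMLE (hd : 1 ≤ d) (hn : d ≤ n) :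
    Integrable (fun y : Fin n → EuclideanSpace ℝ (Fin d) => Real.log (covarianceMLE y).det)
        (Measure.pi fun _ => stdGaussian _) ∧
      ∫ y : Fin n → EuclideanSpace ℝ (Fin d), Real.log (covarianceMLE y).det
        ∂(Measure.pi fun _ => stdGaussian _) =
        ∑ j ∈ Finset.range d, (digamma (((n : ℝ) - j) / 2) - Real.log ((n : ℝ) / 2)) := by
  obtain ⟨hi, he⟩ := integrable_and_integral_log_det_gram (E := EuclideanSpace ℝ (Fin n)) (k := d)
    (by simpa using hn)
  have hm := (measurable_det_gram (E := EuclideanSpace ℝ (Fin n)) d).log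
  have hc := (measurable_sampleColumns (d := d) (n := n)).aemeasurable
    (μ := Measure.pi fun _ : Fin n => stdGaussian (EuclideanSpace ℝ (Fin d)))
  rw [← map_sampleColumns_pi_stdGaussian, integrable_map_measure hm.aestronglyMeasurable hc] at hi
  rw [← map_sampleColumns_pi_stdGaussian, integral_map hc hm.aestronglyMeasurable] at he
  have hn0 : (n : ℝ) ≠ 0 := by exact_mod_cast (by omega : n ≠ 0)
  have hae : (fun y : Fin n → EuclideanSpace ℝ (Fin d) => Real.log (covarianceMLE y).det)
      =ᵐ[Measure.pi fun _ => stdGaussian _]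
      fun y => Real.log (gram ℝ (sampleColumns y)).det - d * Real.log n := by
    filter_upwards [ae_det_covarianceMLE_ne_zero hd hn] with y hy
    rw [det_covarianceMLE] at hy ⊢
    rw [Real.log_mul (left_ne_zero_of_mul hy) (right_ne_zero_of_mul hy), Real.log_pow, one_div,
      Real.log_inv]
    ring
  refine ⟨(hi.sub (integrable_const _)).congr hae.symm, ?_⟩
  rw [integral_congr_ae hae, integral_sub (by exact hi) (integrable_const _), he,
    Real.log_div hn0 (by simp)]
  simp only [Finset.sum_add_distrib, Finset.sum_sub_distrib]
  simp
  ring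

/-- An average of `n` squared norms, each of mean `d`; it cancels the `-d` in the divergence. -/
theorem integrable_and_integral_trace_covarianceMLE (hn : 1 ≤ n) :
    Integrable (fun y : Fin n → EuclideanSpace ℝ (Fin d) => (covarianceMLE y).trace)
        (Measure.pi fun _ => stdGaussian _) ∧
      ∫ y : Fin n → EuclideanSpace ℝ (Fin d), (covarianceMLE y).trace
        ∂(Measure.pi fun _ => stdGaussian _) = d := by
  have hsq := integrable_and_integral_quadratic_multivariateGaussian
    (A := (1 : Matrix (Fin d) (Fin d) ℝ)) PosSemidef.one 1
  simp only [multivariateGaussian_zero_one, one_mulVec, mul_one, trace_one, Fintype.card_fin] at hsq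
  have htr : (fun y : Fin n → EuclideanSpace ℝ (Fin d) => (covarianceMLE y).trace) =
      fun y => (1 / (n : ℝ)) * ∑ i, (y i).ofLp ⬝ᵥ (y i).ofLp := by
    funext y
    simp [covarianceMLE, trace_smul, trace_sum, trace_vecMulVec]
  have hi : ∀ i : Fin n, Integrable (fun y : Fin n → EuclideanSpace ℝ (Fin d) =>
      (y i).ofLp ⬝ᵥ (y i).ofLp) (Measure.pi fun _ => stdGaussian _) := fun i =>
    integrable_comp_eval (μ := fun _ : Fin n => stdGaussian (EuclideanSpace ℝ (Fin d))) hsq.1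
  rw [htr]
  refine ⟨(integrable_finsetSum _ fun i _ => hi i).const_mul _, ?_⟩
  rw [integral_const_mul, integral_finsetSum _ fun i _ => hi i]
  have he : ∀ i : Fin n, ∫ y : Fin n → EuclideanSpace ℝ (Fin d), (y i).ofLp ⬝ᵥ (y i).ofLp
      ∂(Measure.pi fun _ => stdGaussian _) = d := fun i =>
    (integral_comp_eval (μ := fun _ : Fin n => stdGaussian (EuclideanSpace ℝ (Fin d)))
      hsq.1.aestronglyMeasurable).trans hsq.2
  simp only [he]
  have hn0 : (n : ℝ) ≠ 0 := by exact_mod_cast (by omega : n ≠ 0)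
  simp [hn0]

end Sample

/-! ### Monotonicity of `log - ψ` -/

section Digamma

open Real

theorem differentiableAt_log_Gamma {x : ℝ} (hx : 0 < x) :
    DifferentiableAt ℝ (fun t : ℝ => log (Gamma t)) x :=
  (differentiableAt_Gamma fun m => by
    have : (0 : ℝ) ≤ m := m.cast_nonneg
    linarith).log (Gamma_pos_of_pos hx).ne'

theorem digamma_add_one {x : ℝ} (hx : 0 < x) : digamma (x + 1) = digamma x + 1 / x := by
  have h : (fun t : ℝ => log (Gamma (t + 1))) =ᶠ[nhds x] fun t => log t + log (Gamma t) := by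
    filter_upwards [Ioi_mem_nhds hx] with t (ht : 0 < t)
    rw [Gamma_add_one ht.ne', log_mul ht.ne' (Gamma_pos_of_pos ht).ne']
  rw [digamma, ← deriv_comp_add_const, h.deriv_eq,
    deriv_fun_add (differentiableAt_log hx.ne') (differentiableAt_log_Gamma hx), deriv_log]
  rw [digamma, add_comm, one_div]

/-- By convexity of `log Γ`, this slope lies between `ψ(x)` and `ψ(x + 1)`, which yields `0 ≤ log x
- ψ(x) ≤ 1/x`. -/
theorem slope_log_Gamma {x : ℝ} (hx : 0 < x) :
    slope (fun t : ℝ => log (Gamma t)) x (x + 1) = log x := by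
  rw [slope_def_field, Gamma_add_one hx.ne', log_mul hx.ne' (Gamma_pos_of_pos hx).ne']
  ring

theorem digamma_le_log {x : ℝ} (hx : 0 < x) : digamma x ≤ log x := by
  rw [← slope_log_Gamma hx]
  exact convexOn_log_Gamma.deriv_le_slope (Set.mem_Ioi.2 hx) (Set.mem_Ioi.2 (by linarith))
    (by linarith) (differentiableAt_log_Gamma hx)

theorem log_sub_inv_le_digamma {x : ℝ} (hx : 0 < x) : log x - 1 / x ≤ digamma x := by
  have h := convexOn_log_Gamma.slope_le_deriv (Set.mem_Ioi.2 hx)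
    (Set.mem_Ioi.2 (by linarith : 0 < x + 1)) (by linarith)
    (differentiableAt_log_Gamma (by linarith))
  have h' : log x ≤ digamma (x + 1) := (slope_log_Gamma hx).symm.le.trans h
  rw [digamma_add_one hx] at h'
  linarith

/-- Each side is the drop of `log - ψ` over a unit step; the comparison follows from `log u ≤ u - 1`
at `u = (x+1)y / (x(y+1))`. -/
theorem inv_sub_log_strictAnti {x y : ℝ} (hx : 0 < x) (hxy : x < y) :
    1 / y - (log (y + 1) - log y) < 1 / x - (log (x + 1) - log x) := by
  have hy : 0 < y := hx.trans hxy
  have h1 : log ((x + 1) * y / (x * (y + 1))) ≤ (x + 1) * y / (x * (y + 1)) - 1 :=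
    log_le_sub_one_of_pos (by positivity)
  rw [log_div (by positivity) (by positivity), log_mul (by positivity) (by positivity),
    log_mul (by positivity) (by positivity)] at h1
  have h2 : (x + 1) * y / (x * (y + 1)) - 1 = (y - x) / (x * (y + 1)) := by
    field_simp
    ring
  have h3 : 1 / x - 1 / y = (y - x) / (x * y) := by field_simp
  have h4 : (y - x) / (x * (y + 1)) < (y - x) / (x * y) := by
    apply div_lt_div_of_pos_left (by linarith) (by positivity)
    nlinarith
  linarith

/-- The function `log - ψ` is strictly decreasing on the positive reals. -/
theorem log_sub_digamma_strictAnti {x y : ℝ} (hx : 0 < x) (hxy : x < y) :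
    log y - digamma y < log x - digamma x := by
  have hy : 0 < y := hx.trans hxy
  set g : ℝ → ℝ := fun t => log t - digamma t with hg
  have hstep : ∀ t, 0 < t → g (t + 1) = g t - (1 / t - (log (t + 1) - log t)) := by
    intro t ht
    simp only [hg]
    rw [digamma_add_one ht]
    ring
  have hlim : ∀ t, 0 < t → Filter.Tendsto (fun k : ℕ => g (t + k)) Filter.atTop (nhds 0) := by
    intro t ht
    have hk : Filter.Tendsto (fun k : ℕ => 1 / (t + (k : ℝ))) Filter.atTop (nhds 0) :=
      (Filter.tendsto_atTop_add_const_left _ t tendsto_natCast_atTop_atTop).const_div_atTop 1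
    refine squeeze_zero (fun k => ?_) (fun k => ?_) hk
    · exact sub_nonneg.2 (digamma_le_log (by positivity))
    · have := log_sub_inv_le_digamma (x := t + k) (by positivity)
      simp only [hg]
      linarith
  -- This sequence strictly decreases to `0`, so its value at `k = 1` is nonnegative and its value
  -- at `k = 0` strictly positive.
  have hanti : StrictAnti fun k : ℕ => g (x + k) - g (y + k) := by
    refine strictAnti_nat_of_succ_lt fun k => ?_
    have h := inv_sub_log_strictAnti (x := x + k) (y := y + k) (by positivity) (by linarith)
    push_cast
    rw [← add_assoc, ← add_assoc, hstep (x + k) (by positivity), hstep (y + k) (by positivity)]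
    linarith
  have h1 := hanti (show 0 < 1 by norm_num)
  have h2 := hanti.antitone.le_of_tendsto ((hlim x hx).sub (hlim y hy)) 1
  simp only [sub_zero, Nat.cast_zero, add_zero] at h1 h2
  have h3 := h2.trans_lt h1
  simp only [hg] at h3
  linarith

theorem sum_log_sub_digamma_strictAnti {d n : ℕ} (hd : 1 ≤ d) (hn : d ≤ n) :
    ∑ j ∈ Finset.range d, (log (((n + 1 : ℕ) : ℝ) / 2) - digamma ((((n + 1 : ℕ) : ℝ) - j) / 2)) <
      ∑ j ∈ Finset.range d, (log ((n : ℝ) / 2) - digamma (((n : ℝ) - j) / 2)) := by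
  refine Finset.sum_lt_sum_of_nonempty ⟨0, Finset.mem_range.2 hd⟩ fun j hj => ?_
  have hjn : (j : ℝ) + 1 ≤ n := by
    have := Finset.mem_range.1 hj
    exact_mod_cast (by omega : j + 1 ≤ n)
  have hj0 : (0 : ℝ) ≤ j := j.cast_nonneg
  push_cast
  have h1 := log_sub_digamma_strictAnti (x := ((n : ℝ) - j) / 2) (y := ((n : ℝ) + 1 - j) / 2)
    (by linarith) (by linarith)
  -- This is `(n+1)/(n+1-j) ≤ n/(n-j)`, an equality at `j = 0`; strictness comes from `h1`.
  have h2 : log (((n : ℝ) + 1) / 2) + log (((n : ℝ) - j) / 2) ≤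
      log ((n : ℝ) / 2) + log (((n : ℝ) + 1 - j) / 2) := by
    have a1 : 0 < ((n : ℝ) - j) / 2 := by linarith
    have a2 : 0 < ((n : ℝ) + 1 - j) / 2 := by linarith
    have a3 : 0 < (n : ℝ) / 2 := by linarith
    have a4 : 0 < ((n : ℝ) + 1) / 2 := by linarith
    rw [← log_mul a4.ne' a1.ne', ← log_mul a3.ne' a2.ne']
    apply log_le_log (mul_pos a4 a1)
    nlinarith
  linarith

end Digamma

/-! ### Reduction to the identity covariance and evaluation of the risk -/

section Risk

open Matrix
open scoped MatrixOrder

variable {d n : ℕ}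

theorem trace_inv_mul_sqrt_conj {S : Matrix (Fin d) (Fin d) ℝ} (hS : S.PosDef)
    (M : Matrix (Fin d) (Fin d) ℝ) :
    (S⁻¹ * (CFC.sqrt S * M * (CFC.sqrt S)ᵀ)).trace = M.trace := by
  set R := CFC.sqrt S
  have hR : Rᵀ = R := isHermitian_sqrt S
  have hRR : R * R = S := CFC.sqrt_mul_sqrt_self S hS.posSemidef.nonneg
  have hu : IsUnit R.det := by
    refine isUnit_iff_ne_zero.2 fun h => hS.det_pos.ne ?_
    rw [← hRR, det_mul, h, mul_zero]
  rw [hR, ← hRR, Matrix.mul_inv_rev, trace_mul_comm, Matrix.mul_assoc (R * M),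
    mul_nonsing_inv_cancel_left _ _ hu, trace_mul_comm, ← Matrix.mul_assoc,
    nonsing_inv_mul _ hu, Matrix.one_mul]

theorem det_sqrt_conj {S : Matrix (Fin d) (Fin d) ℝ} (hS : S.PosSemidef)
    (M : Matrix (Fin d) (Fin d) ℝ) :
    (CFC.sqrt S * M * (CFC.sqrt S)ᵀ).det = S.det * M.det := by
  rw [det_mul, det_mul, det_transpose, ← det_sqrt_sq hS]
  ring

/-- A Gaussian sample with covariance `S` has the law of a standard Gaussian sample transformed by
the square root of `S`. -/
theorem pi_multivariateGaussian_eq_map (S : Matrix (Fin d) (Fin d) ℝ) :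
    (Measure.pi fun _ : Fin n => multivariateGaussian 0 S) =
      (Measure.pi fun _ : Fin n => stdGaussian (EuclideanSpace ℝ (Fin d))).map
        fun y i => toEuclideanCLM (𝕜 := ℝ) (CFC.sqrt S) (y i) := by
  have hs : ∀ _ : Fin n, SigmaFinite ((stdGaussian (EuclideanSpace ℝ (Fin d))).map
      (toEuclideanCLM (𝕜 := ℝ) (CFC.sqrt S))) := fun _ => by
    rw [← multivariateGaussian_zero_eq_map]
    infer_instance
  rw [Measure.pi_map_pi (fun _ => by fun_prop)]
  simp_rw [← multivariateGaussian_zero_eq_map]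

open Real in
/-- The reverse Kullback–Leibler risk for a sample of size `n ≥ d`. -/
theorem reverseKLRisk_eq_ofReal {S : Matrix (Fin d) (Fin d) ℝ} (hS : S.PosDef) (hd : 1 ≤ d)
    (hn : d ≤ n) {Ω : Type*} [MeasurableSpace Ω] {P : Measure Ω} [IsProbabilityMeasure P]
    {X : Fin n → Ω → EuclideanSpace ℝ (Fin d)}
    (hlaw : ∀ i, HasLaw (X i) (multivariateGaussian 0 S) P) (hindep : iIndepFun X P) :
    0 ≤ 1 / 2 * ∑ j ∈ Finset.range d, (log ((n : ℝ) / 2) - digamma (((n : ℝ) - j) / 2)) ∧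
    reverseKLRisk P X S = ENNReal.ofReal (1 / 2 * ∑ j ∈ Finset.range d,
        (log ((n : ℝ) / 2) - digamma (((n : ℝ) - j) / 2))) := by
  set μ : Measure (Fin n → EuclideanSpace ℝ (Fin d)) := Measure.pi fun _ => stdGaussian _
  set T : (Fin n → EuclideanSpace ℝ (Fin d)) → Fin n → EuclideanSpace ℝ (Fin d) :=
    fun y i => toEuclideanCLM (𝕜 := ℝ) (CFC.sqrt S) (y i) with hT
  have hTm : Measurable T := by fun_prop
  -- For an estimate `A`, `h` gives the divergence only when `det A ≠ 0`: at a singular `A` it is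
  -- finite because `log 0 = 0`, while the divergence is `∞`. Hence the almost sure statements
  -- below.
  set h : Matrix (Fin d) (Fin d) ℝ → ℝ := fun A =>
    1 / 2 * ((S⁻¹ * A).trace - Fintype.card (Fin d) - (log A.det - log S.det)) with hh
  have hjoint := hindep.hasLaw_pi hlaw
  have hlawX : P.map (fun ω i => X i ω) = μ.map T := by
    rw [hjoint.map_eq, pi_multivariateGaussian_eq_map]
  have hdetm : MeasurableSet {x : Fin n → EuclideanSpace ℝ (Fin d) | (covarianceMLE x).det ≠ 0} :=
    (continuous_covarianceMLE.matrix_det.measurable (measurableSet_singleton 0)).compl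
  have hhm : Measurable fun x : Fin n → EuclideanSpace ℝ (Fin d) => h (covarianceMLE x) := by
    have h1 : Measurable fun x : Fin n → EuclideanSpace ℝ (Fin d) =>
        (S⁻¹ * covarianceMLE x).trace :=
      (continuous_const.matrix_mul continuous_covarianceMLE).matrix_trace.measurable
    have h2 : Measurable fun x : Fin n → EuclideanSpace ℝ (Fin d) => log (covarianceMLE x).det :=
      continuous_covarianceMLE.matrix_det.measurable.log
    exact ((h1.sub_const _).sub (h2.sub_const _)).const_mul _
  have hμdet : ∀ᵐ y ∂μ, (covarianceMLE y).det ≠ 0 := ae_det_covarianceMLE_ne_zero hd hn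
  have hTdet : ∀ᵐ y ∂μ, (covarianceMLE (T y)).det ≠ 0 := by
    filter_upwards [hμdet] with y hy
    rw [hT, covarianceMLE_map, det_sqrt_conj hS.posSemidef]
    exact mul_ne_zero hS.det_pos.ne' hy
  have hXdet : ∀ᵐ ω ∂P, (covarianceMLE fun i => X i ω).det ≠ 0 := by
    have : ∀ᵐ x ∂(P.map fun ω i => X i ω), (covarianceMLE x).det ≠ 0 := by
      rw [hlawX]
      exact (ae_map_iff hTm.aemeasurable hdetm).2 hTdet
    exact ae_of_ae_map hjoint.aemeasurable this
  have hkl : ∀ x : Fin n → EuclideanSpace ℝ (Fin d), (covarianceMLE x).det ≠ 0 →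
      0 ≤ h (covarianceMLE x) ∧
      klDiv (multivariateGaussian 0 (covarianceMLE x)) (multivariateGaussian 0 S) =
        ENNReal.ofReal (h (covarianceMLE x)) := fun x hx =>
    klDiv_multivariateGaussian ((posSemidef_covarianceMLE x).posDef_iff_det_ne_zero.2 hx) hS
  have hhT : (fun y => h (covarianceMLE (T y))) =ᵐ[μ]
      fun y => 1 / 2 * ((covarianceMLE y).trace - d - log (covarianceMLE y).det) := by
    filter_upwards [hμdet] with y hy
    simp only [hh, hT]
    rw [covarianceMLE_map, det_sqrt_conj hS.posSemidef, trace_inv_mul_sqrt_conj hS,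
      log_mul hS.det_pos.ne' hy, add_sub_cancel_left, Fintype.card_fin]
  obtain ⟨hi1, he1⟩ := integrable_and_integral_trace_covarianceMLE (d := d) (n := n) (hd.trans hn)
  obtain ⟨hi2, he2⟩ := integrable_and_integral_log_det_covarianceMLE hd hn
  have hi3 : Integrable (fun y : Fin n → EuclideanSpace ℝ (Fin d) =>
      (covarianceMLE y).trace - d) μ := hi1.sub (integrable_const _)
  have hint : Integrable (fun y => h (covarianceMLE (T y))) μ :=
    ((hi3.sub hi2).const_mul _).congr hhT.symm
  have hval : ∫ y, h (covarianceMLE (T y)) ∂μ =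
      1 / 2 * ∑ j ∈ Finset.range d, (log ((n : ℝ) / 2) - digamma (((n : ℝ) - j) / 2)) := by
    rw [integral_congr_ae hhT, integral_const_mul, integral_sub hi3 hi2,
      integral_sub hi1 (integrable_const _), he1, he2]
    simp
  have hnn : 0 ≤ᵐ[μ] fun y => h (covarianceMLE (T y)) := hTdet.mono fun y hy => (hkl _ hy).1
  rw [← hval]
  refine ⟨integral_nonneg_of_ae hnn, ?_⟩
  rw [ofReal_integral_eq_lintegral_ofReal hint hnn, reverseKLRisk,
    lintegral_congr_ae (hXdet.mono fun ω hω => (hkl _ hω).2),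
    ← lintegral_map hhm.ennreal_ofReal hTm, ← hlawX,
    lintegral_map' hhm.ennreal_ofReal.aemeasurable hjoint.aemeasurable]

/-- The reverse Kullback–Leibler risk is infinite for samples smaller than the dimension. -/
theorem reverseKLRisk_eq_top {S : Matrix (Fin d) (Fin d) ℝ} (hS : S.PosDef)
    (hn : n < d) {Ω : Type*} [MeasurableSpace Ω] {P : Measure Ω} [IsProbabilityMeasure P]
    (X : Fin n → Ω → EuclideanSpace ℝ (Fin d)) :
    reverseKLRisk P X S = ∞ := by
  simp [reverseKLRisk, klDiv_multivariateGaussian_of_det_eq_zero (posSemidef_covarianceMLE _)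
    (det_covarianceMLE_of_lt hn _) hS]

end Risk

theorem proposition6 {d : ℕ} (hd : 1 ≤ d) (S : Matrix (Fin d) (Fin d) ℝ) (hS : S.PosDef)
    -- for every `n`, an i.i.d. sample `X₁, …, Xₙ` from `N(0, S)`, on any probability space
    (Ω : ℕ → Type*) [∀ n, MeasurableSpace (Ω n)] (P : ∀ n, Measure (Ω n))
    [∀ n, IsProbabilityMeasure (P n)]
    (X : ∀ n : ℕ, Fin n → Ω n → EuclideanSpace ℝ (Fin d))
    (hlaw : ∀ n i, HasLaw (X n i) (multivariateGaussian 0 S) (P n))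
    (hindep : ∀ n, iIndepFun (X n) (P n)) :
    (∀ n : ℕ, d ≤ n →
      (reverseKLRisk (P n) (X n) S : EReal) =
        ((1 / 2 * (d * Real.log ((n : ℝ) / 2)
          - ∑ j ∈ Finset.Icc 1 d, digamma (((n : ℝ) - (j : ℝ) + 1) / 2)) : ℝ) : EReal)) ∧
    StrictAntiOn (fun n : ℕ => reverseKLRisk (P n) (X n) S) (Set.Ici d) ∧
    (∀ n : ℕ, 1 ≤ n → n < d → reverseKLRisk (P n) (X n) S = ∞) := by
  have hrisk := fun (n : ℕ) (hn : d ≤ n) =>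
    reverseKLRisk_eq_ofReal hS hd hn (hlaw n) (hindep n)
  refine ⟨fun n hn => ?_, ?_, fun n _ hn => reverseKLRisk_eq_top hS hn (X n)⟩
  · obtain ⟨h0, h⟩ := hrisk n hn
    rw [h, EReal.coe_ennreal_ofReal, max_eq_left h0, EReal.coe_eq_coe_iff,
      Finset.sum_sub_distrib, Finset.sum_const, Finset.card_range, nsmul_eq_mul,
      ← Finset.Ico_add_one_right_eq_Icc, Finset.sum_Ico_eq_sum_range, Nat.add_sub_cancel]
    congr 2
    refine Finset.sum_congr rfl fun j _ => ?_
    push_cast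
    congr 1
    ring
  · have hsucc : ∀ n, d ≤ n →
        reverseKLRisk (P (n + 1)) (X (n + 1)) S < reverseKLRisk (P n) (X n) S := by
      intro n hn
      have hlt := sum_log_sub_digamma_strictAnti hd hn
      obtain ⟨h0, h1⟩ := hrisk (n + 1) (hn.trans n.le_succ)
      rw [h1, (hrisk n hn).2]
      -- Strictness survives `ENNReal.ofReal` because the smaller value is nonnegative.
      exact (ENNReal.ofReal_lt_ofReal_iff_of_nonneg h0).2 (by linarith)
    intro m hm n _ hmn
    have hm' : d ≤ m := hm
    induction n, (hmn : m + 1 ≤ n) using Nat.le_induction with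
    | base => exact hsucc m hm'
    | succ n hle ih =>
      exact (hsucc n (by omega)).trans (ih (Set.mem_Ici.2 (by omega)))
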